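/- Let $C,n\in\mathbb{N}$, let $\mathcal{X}$ be a measurable space, let $f:\mathcal{X}\to\Delta_{C-1}=\{p\in[0,1]^C:\sum_c p_c=1\}$ be a measurable $C$-class classifier, let $\mathcal{D}$ be a probability distribution of labelled data $(x,y)$ with $x\in\mathcal{X}$ and $y$ one of the $C$ one-hot vectors in $\mathbb{R}^C$, and let $S$ be a data set of $|S|=n$ labelled points of this kind (repetitions allowed). For $Q\subseteq\mathbb{R}^{2C}$ put $$D(S,\mathcal{D}|Q)=\bigl|\mathbb{P}_{(x,y)\sim S}((f(x),y)\in Q)-\mathbb{P}_{(x,y)\sim\mathcal{D}}((f(x),y)\in Q)\bigr|,$$ where $(x,y)\sim S$ means uniformly distributed on $S$, and for a family $\mathcal{Q}$ of such sets put $D_{\mathcal{Q}}(S,\mathcal{D})=\sup_{Q\in\mathcal{Q}}D(S,\mathcal{D}|Q)$. Let $\mathcal{Q}'_{cvx}$ be the family of all closed convex subsets of $\mathbb{R}^{2C}$ and, for $K\in\mathbb{N}$, let $\mathcal{Q}'_{cvx,K}$ be the family of all closed convex (possibly unbounded) polytopes with at most $K$ facets, that is, of all sets $\{a\in\mathbb{R}^{2C}: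 w_i^\top a+b_i\le 0,\ i=1,\dots,K\}$ with $w_i\in\mathbb{R}^{2C}$, $b_i\in\mathbb{R}$. If $|S|\ge 4C$, then $$D_{\mathcal{Q}'_{cvx}}(S,\mathcal{D})=D_{\mathcal{Q}'_{cvx,K}}(S,\mathcal{D})\qquad\text{for } K=\binom{|S|}{2C}.$$ -/

import Mathlib

open MeasureTheory

namespace CvxDiscrepancy

/-- The ambient space `ℝ^{2C} = ℝ^C × ℝ^C` of pairs (predicted probabilities, label vector). -/
abbrev Ambient (C : ℕ) : Type := Fin C ⊕ Fin C → ℝ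

/-- The vector `(f(x), y) ∈ ℝ^{2C}` of a labelled point `z = (x, y)`, the label `y ∈ [C]` being
written in one-hot format. -/
def feature {X : Type*} {C : ℕ} (f : X → Fin C → ℝ) (z : X × Fin C) : Ambient C :=
  Sum.elim (f z.1) (Pi.single z.2 1)

/-- `ℙ_{(x, y) ∼ S}((f(x), y) ∈ Q)`, for `(x, y)` uniform on the data set `S` of size `n`
(a family, so repeated data points are counted with multiplicity). -/
noncomputable def sampleProb {X : Type*} {C n : ℕ} (f : X → Fin C → ℝ) (S : Fin n → X × Fin C)
    (Q : Set (Ambient C)) : ℝ :=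
  (Nat.card {i : Fin n // feature f (S i) ∈ Q} : ℝ) / (n : ℝ)

/-- `ℙ_{(x, y) ∼ 𝒟}((f(x), y) ∈ Q)`. -/
noncomputable def distProb {X : Type*} [MeasurableSpace X] {C : ℕ} (f : X → Fin C → ℝ)
    (𝒟 : Measure (X × Fin C)) (Q : Set (Ambient C)) : ℝ :=
  𝒟.real {z | feature f z ∈ Q}

/-- `D(S, 𝒟 | Q)`, the discrepancy between `S` and `𝒟` on a single set `Q`. -/
noncomputable def discrepancyOn {X : Type*} [MeasurableSpace X] {C n : ℕ} (f : X → Fin C → ℝ)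
    (S : Fin n → X × Fin C) (𝒟 : Measure (X × Fin C)) (Q : Set (Ambient C)) : ℝ :=
  |sampleProb f S Q - distProb f 𝒟 Q|

/-- The discrepancy distance `sup_{Q ∈ 𝒬} D(S, 𝒟 | Q)` with respect to a family `𝒬` of sets.
For a probability measure `𝒟` all the values lie in `[0, 1]`, so the supremum is a genuine one
for every non-empty `𝒬`. -/
noncomputable def discrepancy {X : Type*} [MeasurableSpace X] {C n : ℕ} (f : X → Fin C → ℝ)
    (S : Fin n → X × Fin C) (𝒟 : Measure (X × Fin C)) (𝒬 : Set (Set (Ambient C))) : ℝ :=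
  sSup (discrepancyOn f S 𝒟 '' 𝒬)

/-- All closed convex subsets of `ℝ^{2C}`. -/
def closedConvexSets (C : ℕ) : Set (Set (Ambient C)) :=
  {Q | IsClosed Q ∧ Convex ℝ Q}

/-- All closed convex polytopes in `ℝ^{2C}` with at most `K` facets, i.e. all sets
`{a | w_iᵀ a + b_i ≤ 0 for all i ∈ [K]}` with `w_i ∈ ℝ^{2C}` and `b_i ∈ ℝ`. -/
def closedConvexPolytopes (C K : ℕ) : Set (Set (Ambient C)) :=
  {Q | ∃ (w : Fin K → Ambient C) (b : Fin K → ℝ), Q = {a | ∀ i, w i ⬝ᵥ a + b i ≤ 0}}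

end CvxDiscrepancy

/-!
Let `s` be the set of sample points in `ℝ^d`, `d = 2 * C`. A closed convex set `Q` is sandwiched
between two polyhedra that contain the same points of `s`: the convex hull of `s ∩ Q`, and an
intersection of half-spaces separating `Q` from the points of `s \ Q`. As `distProb` is monotone,
the discrepancy on `Q` is at most that on one of the two.

The outer polyhedron needs at most `n` inequalities. For the inner one let `k` be the dimension of
the affine span of `s ∩ Q`. Inside that span every facet of the hull is determined by `k` points
of `s`, which gives at most `n.choose k` inequalities, and the span itself is cut out by `d - k`
equations, i.e. `2 * (d - k)` inequalities. The total is at most `n.choose d` because `2 * d ≤ n`.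
-/

open Module

namespace CvxDiscrepancy

section Choose

theorem self_le_choose {n k : ℕ} (hk : 0 < k) (hkn : k < n) : n ≤ n.choose k := by
  obtain ⟨k, rfl⟩ := Nat.exists_eq_add_one.mpr hk
  induction n generalizing k with
  | zero => omega
  | succ n ih =>
    rw [Nat.choose_succ_succ']
    have h1 : 0 < n.choose k := Nat.choose_pos (by omega)
    rcases Nat.lt_or_ge (k + 1) n with h | h
    · have := ih k hk h
      omega
    · obtain rfl : n = k + 1 := by omega
      simp

theorem choose_add_two_le_choose_succ {n k : ℕ} (hk : 2 * (k + 1) ≤ n) (hn : 3 ≤ n) :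
    n.choose k + 2 ≤ n.choose (k + 1) := by
  rcases Nat.eq_zero_or_pos k with rfl | hpos
  · simpa using hn
  have hle : n ≤ n.choose k := self_le_choose hpos (by omega)
  refine Nat.le_of_mul_le_mul_right (c := k + 1) ?_ k.succ_pos
  calc (n.choose k + 2) * (k + 1) = n.choose k * (k + 1) + 2 * (k + 1) := by ring
    _ ≤ n.choose k * (k + 1) + n.choose k := by gcongr; exact hk.trans hle
    _ = n.choose k * (k + 2) := by ring
    _ ≤ n.choose k * (n - k) := by gcongr; omega
    _ = n.choose (k + 1) * (k + 1) := (Nat.choose_succ_right_eq n k).symm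

theorem choose_add_two_mul_sub_le_choose {n k d : ℕ} (hkd : k ≤ d) (hdn : 2 * d ≤ n)
    (hd : d ≠ 1) : n.choose k + 2 * (d - k) ≤ n.choose d := by
  rcases Nat.eq_zero_or_pos d with rfl | hpos
  · simp [Nat.le_zero.mp hkd]
  have hn : 3 ≤ n := by omega
  clear hd hpos
  induction d, hkd using Nat.le_induction with
  | base => simp
  | succ d hkd ih =>
    have := choose_add_two_le_choose_succ hdn hn
    have := ih (by omega)
    omega

end Choose

section Span

theorem exists_mem_ne_zero_of_mem_span {R M N : Type*} [Semiring R] [AddCommMonoid M] [Module R M]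
    [AddCommMonoid N] [Module R N] {s : Set M} {φ : M →ₗ[R] N} {x : M}
    (hx : x ∈ Submodule.span R s) (hφx : φ x ≠ 0) : ∃ y ∈ s, φ y ≠ 0 := by
  by_contra! hcon
  exact hφx (LinearMap.eqOn_span (g := 0) hcon hx)

theorem exists_finset_card_eq_finrank_span_eq {K M : Type*} [DivisionRing K] [AddCommGroup M]
    [Module K M] {s : Set M} [FiniteDimensional K (Submodule.span K s)] {k : ℕ}
    (hk : k ≤ finrank K (Submodule.span K s)) :
    ∃ J : Finset M, ↑J ⊆ s ∧ J.card = k ∧ finrank K (Submodule.span K (J : Set M)) = k := by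
  obtain ⟨t, hts, htc, -, hli⟩ := Submodule.exists_finset_span_eq_linearIndepOn K s
  obtain ⟨J, hJt, hJk⟩ := Finset.exists_subset_card_eq (htc ▸ hk)
  refine ⟨J, (Finset.coe_subset.mpr hJt).trans hts, hJk, ?_⟩
  have := finrank_span_finset_eq_card (hli.mono (Finset.coe_subset.mpr hJt))
  exact this.trans hJk

end Span

section Cone

variable {𝕜 V : Type*} [Field 𝕜] [LinearOrder 𝕜] [IsStrictOrderedRing 𝕜] [AddCommGroup V]
  [Module 𝕜 V]

theorem mem_hull_insert_of_add_smul_mem_hull {A : Set V} {ψ : Dual 𝕜 V} {a x : V}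
    (hψ : ∀ y ∈ A, 0 ≤ ψ y) (hψx : ψ x ≤ 0)
    (hx : x + ψ x • a ∈ PointedCone.hull 𝕜 ((fun y => y + ψ y • a) '' A)) :
    x ∈ PointedCone.hull 𝕜 (insert a A) := by
  have ha : a ∈ PointedCone.hull 𝕜 (insert a A) := PointedCone.subset_hull (Set.mem_insert a A)
  have hle : PointedCone.hull 𝕜 ((fun y => y + ψ y • a) '' A) ≤
      PointedCone.hull 𝕜 (insert a A) := by
    refine Submodule.span_le.mpr ?_
    rintro _ ⟨y, hy, rfl⟩
    exact add_mem (PointedCone.subset_hull (Set.mem_insert_of_mem a hy))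
      (PointedCone.smul_mem _ (hψ y hy) ha)
  simpa using add_mem (hle hx) (PointedCone.smul_mem _ (neg_nonneg.mpr hψx) ha)

theorem mem_hull_image_of_forall_dual_nonneg {ι : Type*} {s : Finset ι} {v : ι → V} {x : V}
    (h : ∀ φ : Dual 𝕜 V, (∀ i ∈ s, 0 ≤ φ (v i)) → 0 ≤ φ x) :
    x ∈ PointedCone.hull 𝕜 (v '' s) := by
  classical
  induction s using Finset.induction_on generalizing v x with
  | empty =>
    have hx : x = 0 := (forall_dual_apply_eq_zero_iff 𝕜 x).mp fun φ =>
      le_antisymm (by simpa using h (-φ) (by simp)) (h φ (by simp))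
    exact hx ▸ zero_mem _
  | insert a t _ ih =>
    by_cases hx : ∀ φ : Dual 𝕜 V, (∀ i ∈ t, 0 ≤ φ (v i)) → 0 ≤ φ x
    · exact Submodule.span_mono (Set.image_mono (Finset.coe_subset.mpr (t.subset_insert a))) (ih hx)
    push Not at hx
    obtain ⟨φ, hφt, hφx⟩ := hx
    have hφa : φ (v a) < 0 := by
      by_contra! hφa
      exact (h φ (Finset.forall_mem_insert _ _ _ |>.mpr ⟨hφa, hφt⟩)).not_gt hφx
    have hinv : 0 < (-φ (v a))⁻¹ := inv_pos.mpr (neg_pos.mpr hφa)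
    obtain ⟨ψ, hψt, hψx, hψa⟩ :
        ∃ ψ : Dual 𝕜 V, (∀ i ∈ t, 0 ≤ ψ (v i)) ∧ ψ x ≤ 0 ∧ ψ (v a) = -1 := by
      refine ⟨(-φ (v a))⁻¹ • φ, fun i hi => mul_nonneg hinv.le (hφt i hi),
        mul_nonpos_of_nonneg_of_nonpos hinv.le hφx.le, ?_⟩
      simp [inv_neg, hφa.ne]
    -- `y ↦ y + ψ y • v a` projects along `v a` onto `ker ψ`; the induction runs on the projections.
    have hproj : x + ψ x • v a ∈ PointedCone.hull 𝕜 ((fun i => v i + ψ (v i) • v a) '' t) := by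
      refine ih fun χ hχ => ?_
      have := h (χ + χ (v a) • ψ) (Finset.forall_mem_insert _ _ _ |>.mpr
        ⟨by simp [hψa], fun i hi => by simpa [mul_comm] using hχ i hi⟩)
      simpa [mul_comm] using this
    rw [Finset.coe_insert, Set.image_insert_eq]
    exact mem_hull_insert_of_add_smul_mem_hull (Set.forall_mem_image.mpr hψt) hψx
      (by rwa [Set.image_image])

theorem mem_hull_iff_forall_dual_nonneg {A : Set V} (hA : A.Finite) {x : V} :
    x ∈ PointedCone.hull 𝕜 A ↔ ∀ φ : Dual 𝕜 V, (∀ y ∈ A, 0 ≤ φ y) → 0 ≤ φ x := by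
  lift A to Finset V using hA
  refine ⟨fun hx φ hφ => ?_, fun h => ?_⟩
  · exact (Submodule.span_le (p := PointedCone.dual LinearMap.id {φ})).mpr
      (fun y hy => by simpa using hφ y hy) hx (Set.mem_singleton φ)
  · simpa using mem_hull_image_of_forall_dual_nonneg (v := id) h

theorem exists_forall_nonneg_add_mul {ι : Type*} {s : Finset ι} {u v : ι → 𝕜}
    (hu : ∀ i ∈ s, 0 ≤ u i) (hv : ∃ j ∈ s, v j < 0) :
    ∃ c, (∀ i ∈ s, 0 ≤ u i + c * v i) ∧ ∃ l ∈ s, v l < 0 ∧ u l + c * v l = 0 := by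
  obtain ⟨j, hj, hvj⟩ := hv
  obtain ⟨l, hl, hmin⟩ := {i ∈ s | v i < 0}.exists_min_image (fun i => u i / -v i)
    ⟨j, Finset.mem_filter.mpr ⟨hj, hvj⟩⟩
  simp only [Finset.mem_filter, and_imp] at hl hmin
  refine ⟨u l / -v l, fun i hi => ?_, l, hl.1, hl.2, ?_⟩
  · rcases lt_or_ge (v i) 0 with hvi | hvi
    · have := (le_div_iff₀ (neg_pos.mpr hvi)).mp (hmin i hi hvi)
      linarith
    · have := div_nonneg (hu l hl.1) (neg_pos.mpr hl.2).le
      exact add_nonneg (hu i hi) (mul_nonneg this hvi)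
  · have := hl.2.ne
    field_simp
    ring

theorem exists_nonneg_support_ssubset {A : Finset V} {φ : Dual 𝕜 V} {x : V}
    (hφ : ∀ y ∈ A, 0 ≤ φ y) (hφx : φ x < 0)
    (hrank : finrank 𝕜 (Submodule.span 𝕜 {y ∈ (A : Set V) | φ y = 0}) + 1 <
      finrank 𝕜 (Submodule.span 𝕜 (A : Set V))) :
    ∃ ψ : Dual 𝕜 V, (∀ y ∈ A, 0 ≤ ψ y) ∧ ψ x < 0 ∧ {y ∈ A | ψ y ≠ 0} ⊂ {y ∈ A | φ y ≠ 0} := by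
  set Z := Submodule.span 𝕜 {y ∈ (A : Set V) | φ y = 0}
  have : FiniteDimensional 𝕜 Z :=
    FiniteDimensional.span_of_finite 𝕜 (A.finite_toSet.subset (Set.sep_subset _ _))
  -- Tilt `φ` by a `χ` vanishing at `x` and on the zeros of `φ` until `A` gains a new zero.
  obtain ⟨y, hyA, hy⟩ : ∃ y ∈ A, y ∉ Z ⊔ Submodule.span 𝕜 {x} := by
    by_contra! hcon
    have h1 := Submodule.finrank_mono (Submodule.span_le.mpr hcon)
    have h2 := Submodule.finrank_add_le_finrank_add_finrank Z (Submodule.span 𝕜 {x})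
    have h3 := finrank_span_le_card (R := 𝕜) ({x} : Set V)
    rw [Set.toFinset_singleton, Finset.card_singleton] at h3
    omega
  obtain ⟨χ, hχ, hχy⟩ := LinearMap.exists_extend_of_notMem (0 : _ →ₗ[𝕜] 𝕜) hy (-1)
  have hχ0 : ∀ z ∈ Z ⊔ Submodule.span 𝕜 {x}, χ z = 0 := fun z hz =>
    LinearMap.congr_fun hχ ⟨z, hz⟩
  have hχx : χ x = 0 :=
    hχ0 x (Submodule.mem_sup_right (Submodule.mem_span_singleton_self x))
  have hχA : ∀ z ∈ A, φ z = 0 → χ z = 0 := fun z hz h =>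
    hχ0 z (Submodule.mem_sup_left (Submodule.subset_span ⟨hz, h⟩))
  obtain ⟨c, hc, l, hl, hχl, hcl⟩ :=
    exists_forall_nonneg_add_mul hφ ⟨y, hyA, hχy.trans_lt neg_one_lt_zero⟩
  refine ⟨φ + c • χ, hc, by simpa [hχx] using hφx, ?_⟩
  refine (Finset.ssubset_iff_of_subset fun z hz => ?_).mpr
    ⟨l, Finset.mem_filter.mpr ⟨hl, mt (hχA l hl) hχl.ne⟩, fun h => (Finset.mem_filter.mp h).2 hcl⟩
  obtain ⟨hzA, hz⟩ := Finset.mem_filter.mp hz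
  exact Finset.mem_filter.mpr ⟨hzA, fun h => hz (by simp [h, hχA z hzA h])⟩

theorem exists_nonneg_finrank_span_zeros {A : Finset V} {φ : Dual 𝕜 V} {x : V}
    (hφ : ∀ y ∈ A, 0 ≤ φ y) (hφx : φ x < 0) :
    ∃ ψ : Dual 𝕜 V, (∀ y ∈ A, 0 ≤ ψ y) ∧ ψ x < 0 ∧ finrank 𝕜 (Submodule.span 𝕜 (A : Set V)) ≤
      finrank 𝕜 (Submodule.span 𝕜 {y ∈ (A : Set V) | ψ y = 0}) + 1 := by
  rcases le_or_gt (finrank 𝕜 (Submodule.span 𝕜 (A : Set V)))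
    (finrank 𝕜 (Submodule.span 𝕜 {y ∈ (A : Set V) | φ y = 0}) + 1) with hle | hlt
  · exact ⟨φ, hφ, hφx, hle⟩
  · obtain ⟨ψ, hψ, hψx, hlt⟩ := exists_nonneg_support_ssubset hφ hφx hlt
    have := Finset.card_lt_card hlt
    exact exists_nonneg_finrank_span_zeros hψ hψx
termination_by {y ∈ A | φ y ≠ 0}.card

theorem neg_of_neg_of_vanish_on_hyperplane {A : Finset V} {Z : Submodule 𝕜 V}
    (hZ : Z ≤ Submodule.span 𝕜 A)
    (hrank : finrank 𝕜 (Submodule.span 𝕜 (A : Set V)) ≤ finrank 𝕜 Z + 1) {φ ψ : Dual 𝕜 V}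
    (hφ : ∀ y ∈ A, 0 ≤ φ y) (hφZ : Z ≤ LinearMap.ker φ)
    (hψ : ∀ y ∈ A, 0 ≤ ψ y) (hψZ : Z ≤ LinearMap.ker ψ) (hψA : ∃ y ∈ A, ψ y ≠ 0)
    {x : V} (hx : x ∈ Submodule.span 𝕜 (A : Set V)) (hφx : φ x < 0) : ψ x < 0 := by
  obtain ⟨y, hyA, hy⟩ : ∃ y ∈ A, φ y ≠ 0 := exists_mem_ne_zero_of_mem_span hx hφx.ne
  have hspan : Submodule.span 𝕜 {y} ⊔ Z = Submodule.span 𝕜 A := by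
    have hle : Submodule.span 𝕜 {y} ⊔ Z ≤ Submodule.span 𝕜 A :=
      sup_le (Submodule.span_mono (by simpa using hyA)) hZ
    have := Submodule.finiteDimensional_of_le hle
    refine Submodule.eq_of_le_of_finrank_le hle (hrank.trans ?_)
    exact Submodule.finrank_lt_finrank_of_lt
      (Submodule.covBy_span_singleton_sup fun h => hy (hφZ h)).lt
  have hψy : ψ y ≠ 0 := by
    obtain ⟨w, hwA, hw⟩ := hψA
    refine fun h => hw ?_
    have hker : Submodule.span 𝕜 {y} ⊔ Z ≤ LinearMap.ker ψ :=
      sup_le (by simpa [Submodule.span_le] using h) hψZ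
    exact hker (hspan ▸ Submodule.subset_span hwA)
  rw [← hspan, Submodule.mem_sup] at hx
  obtain ⟨_, hcy, z, hz, rfl⟩ := hx
  obtain ⟨c, rfl⟩ := Submodule.mem_span_singleton.mp hcy
  have hφz : φ z = 0 := hφZ hz
  have hψz : ψ z = 0 := hψZ hz
  simp only [map_add, map_smul, smul_eq_mul, hφz, hψz, add_zero] at hφx ⊢
  exact mul_neg_of_neg_of_pos (neg_of_mul_neg_left hφx (hφ y hyA)) ((hψ y hyA).lt_of_ne' hψy)

theorem exists_finset_card_eq_nonneg_of_notMem_hull {A : Finset V} {x : V}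
    (hx : x ∉ PointedCone.hull 𝕜 (A : Set V)) :
    ∃ J ⊆ A, J.card = finrank 𝕜 (Submodule.span 𝕜 (A : Set V)) - 1 ∧
      finrank 𝕜 (Submodule.span 𝕜 (J : Set V)) = finrank 𝕜 (Submodule.span 𝕜 (A : Set V)) - 1 ∧
      ∃ φ : Dual 𝕜 V, (∀ y ∈ A, 0 ≤ φ y) ∧ (∀ y ∈ J, φ y = 0) ∧ φ x < 0 := by
  obtain ⟨φ₀, hφ₀, hneg⟩ : ∃ φ : Dual 𝕜 V, (∀ y ∈ A, 0 ≤ φ y) ∧ φ x < 0 := by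
    simpa [mem_hull_iff_forall_dual_nonneg A.finite_toSet] using hx
  obtain ⟨φ, hφ, hφx, hrank⟩ := exists_nonneg_finrank_span_zeros hφ₀ hneg
  have : FiniteDimensional 𝕜 (Submodule.span 𝕜 {y ∈ (A : Set V) | φ y = 0}) :=
    FiniteDimensional.span_of_finite 𝕜 (A.finite_toSet.subset (Set.sep_subset _ _))
  obtain ⟨J, hJ, hJc, hJr⟩ := exists_finset_card_eq_finrank_span_eq
    (Nat.sub_le_iff_le_add.mpr hrank)
  exact ⟨J, fun y hy => (hJ hy).1, hJc, hJr, φ, hφ, fun y hy => (hJ hy).2, hφx⟩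

theorem exists_finset_dual_inf_span_eq_hull (A : Finset V) :
    ∃ F : Finset (Dual 𝕜 V),
      F.card ≤ A.card.choose (finrank 𝕜 (Submodule.span 𝕜 (A : Set V)) - 1) ∧
      PointedCone.dual LinearMap.id (F : Set (Dual 𝕜 V)) ⊓ Submodule.span 𝕜 (A : Set V) =
        PointedCone.hull 𝕜 (A : Set V) := by
  classical
  -- When `J` spans a hyperplane of `span A`, functionals satisfying `IsFacet J` agree on `span A`
  -- up to positive multiples, so one representative for each `J` suffices.
  let IsFacet (J : Finset V) (φ : Dual 𝕜 V) : Prop :=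
    (∀ y ∈ A, 0 ≤ φ y) ∧ (∀ y ∈ J, φ y = 0) ∧ ∃ y ∈ A, φ y ≠ 0
  have hfacet : ∀ J, ∃ g : Dual 𝕜 V, (∀ y ∈ A, 0 ≤ g y) ∧ ∀ φ, IsFacet J φ → IsFacet J g := by
    intro J
    by_cases h : ∃ φ, IsFacet J φ
    · obtain ⟨g, hg⟩ := h
      exact ⟨g, hg.1, fun _ _ => hg⟩
    · exact ⟨0, by simp, fun φ hφ => absurd ⟨φ, hφ⟩ h⟩
  choose g hgA hg using hfacet
  refine ⟨(A.powersetCard _).image g,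
    Finset.card_image_le.trans_eq (Finset.card_powersetCard _ A),
    le_antisymm ?_ (le_inf (Submodule.span_le.mpr fun y hy => ?_) (PointedCone.hull_le_span 𝕜 _))⟩
  · rintro x ⟨hF, hx⟩
    by_contra hxA
    obtain ⟨J, hJA, hJc, hJr, φ, hφ, hφJ, hφx⟩ := exists_finset_card_eq_nonneg_of_notMem_hull hxA
    obtain ⟨-, hgJ, hgne⟩ := hg J φ ⟨hφ, hφJ, exists_mem_ne_zero_of_mem_span hx hφx.ne⟩
    have hgx : 0 ≤ g J x :=
      hF (Finset.mem_image_of_mem g (Finset.mem_powersetCard.mpr ⟨hJA, hJc⟩))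
    refine hgx.not_gt ?_
    exact neg_of_neg_of_vanish_on_hyperplane (Submodule.span_mono (Finset.coe_subset.mpr hJA))
      (by omega) hφ (Submodule.span_le.mpr hφJ) (hgA J) (Submodule.span_le.mpr hgJ) hgne hx hφx
  · intro φ hφ
    obtain ⟨J, -, rfl⟩ := Finset.mem_image.mp hφ
    exact hgA J y hy

theorem exists_finset_dual_eq_ofSubmodule [FiniteDimensional 𝕜 V] (L : Submodule 𝕜 V) :
    ∃ F : Finset (Dual 𝕜 V), F.card ≤ 2 * (finrank 𝕜 V - finrank 𝕜 L) ∧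
      PointedCone.dual LinearMap.id (F : Set (Dual 𝕜 V)) = L := by
  classical
  obtain ⟨E, -, hEc, hE, -⟩ :=
    Submodule.exists_finset_span_eq_linearIndepOn 𝕜 (L.dualAnnihilator : Set (Dual 𝕜 V))
  rw [Submodule.span_eq] at hEc hE
  have hLE : ∀ x, x ∈ L ↔ ∀ φ ∈ E, φ x = 0 := fun x => by
    rw [← Subspace.forall_mem_dualAnnihilator_apply_eq_zero_iff, ← hE]
    exact Submodule.span_le (p := LinearMap.ker (Dual.eval 𝕜 V x))
  refine ⟨E ∪ E.image Neg.neg, ?_, ?_⟩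
  · have := Subspace.finrank_add_finrank_dualAnnihilator_eq L
    have := Finset.card_union_le E (E.image Neg.neg)
    have : (E.image Neg.neg).card ≤ E.card := Finset.card_image_le
    omega
  · ext x
    simp only [PointedCone.mem_dual, PointedCone.mem_ofSubmodule_iff, LinearMap.id_apply,
      SetLike.mem_coe, hLE, Finset.mem_union, or_imp, forall_and, Finset.forall_mem_image,
      LinearMap.neg_apply, Left.nonneg_neg_iff, le_antisymm_iff, and_comm]

theorem exists_finset_dual_eq_hull [FiniteDimensional 𝕜 V] (A : Finset V) :
    ∃ F : Finset (Dual 𝕜 V),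
      F.card ≤ A.card.choose (finrank 𝕜 (Submodule.span 𝕜 (A : Set V)) - 1) +
        2 * (finrank 𝕜 V - finrank 𝕜 (Submodule.span 𝕜 (A : Set V))) ∧
      PointedCone.dual LinearMap.id (F : Set (Dual 𝕜 V)) = PointedCone.hull 𝕜 (A : Set V) := by
  classical
  obtain ⟨F₁, hF₁c, hF₁⟩ := exists_finset_dual_inf_span_eq_hull (𝕜 := 𝕜) A
  obtain ⟨F₂, hF₂c, hF₂⟩ := exists_finset_dual_eq_ofSubmodule (Submodule.span 𝕜 (A : Set V))
  refine ⟨F₁ ∪ F₂, (Finset.card_union_le _ _).trans (add_le_add hF₁c hF₂c), ?_⟩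
  rw [Finset.coe_union, PointedCone.dual_union, hF₂, hF₁]

end Cone

section ConvexHull

/-- The affine embedding `x ↦ (x, 1)` of `E` into `E × 𝕜`, which turns affine inequalities on `E`
into linear ones. -/
def homogenization (𝕜 E : Type*) [Ring 𝕜] [AddCommGroup E] [Module 𝕜 E] : E →ᵃ[𝕜] E × 𝕜 :=
  (AffineMap.id 𝕜 E).prod (AffineMap.const 𝕜 E 1)

@[simp]
theorem homogenization_apply {𝕜 E : Type*} [Ring 𝕜] [AddCommGroup E] [Module 𝕜 E] (x : E) :
    homogenization 𝕜 E x = (x, 1) :=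
  rfl

theorem span_homogenization_image {𝕜 E : Type*} [Ring 𝕜] [AddCommGroup E] [Module 𝕜 E]
    {s : Set E} {p : E} (hp : p ∈ s) :
    Submodule.span 𝕜 (homogenization 𝕜 E '' s) =
      (vectorSpan 𝕜 s).map (LinearMap.inl 𝕜 E 𝕜) ⊔ Submodule.span 𝕜 {(p, 1)} := by
  rw [vectorSpan_eq_span_vsub_set_right 𝕜 hp, Submodule.map_span, ← Submodule.span_union]
  refine le_antisymm (Submodule.span_le.mpr ?_) (Submodule.span_le.mpr ?_)
  · rintro _ ⟨x, hx, rfl⟩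
    set t := LinearMap.inl 𝕜 E 𝕜 '' ((· -ᵥ p) '' s) ∪ {(p, 1)}
    have hdiff : (x - p, (0 : 𝕜)) ∈ Submodule.span 𝕜 t :=
      Submodule.subset_span (Or.inl ⟨x - p, ⟨x, hx, rfl⟩, rfl⟩)
    have hbase : (p, (1 : 𝕜)) ∈ Submodule.span 𝕜 t := Submodule.subset_span (Or.inr rfl)
    simpa using add_mem hdiff hbase
  · have hmem : ∀ x ∈ s, (x, (1 : 𝕜)) ∈ Submodule.span 𝕜 (homogenization 𝕜 E '' s) :=
      fun x hx => Submodule.subset_span ⟨x, hx, rfl⟩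
    rintro _ (⟨_, ⟨x, hx, rfl⟩, rfl⟩ | rfl)
    · simpa using sub_mem (hmem x hx) (hmem p hp)
    · exact hmem p hp

theorem finrank_span_homogenization_image {𝕜 E : Type*} [Field 𝕜] [AddCommGroup E] [Module 𝕜 E]
    [FiniteDimensional 𝕜 E] {s : Set E} (hs : s.Nonempty) :
    finrank 𝕜 (Submodule.span 𝕜 (homogenization 𝕜 E '' s)) = finrank 𝕜 (vectorSpan 𝕜 s) + 1 := by
  obtain ⟨p, hp⟩ := hs
  have hp' : (p, (1 : 𝕜)) ∉ (vectorSpan 𝕜 s).map (LinearMap.inl 𝕜 E 𝕜) := by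
    rintro ⟨v, -, hv⟩
    exact zero_ne_one (congrArg Prod.snd hv)
  rw [span_homogenization_image hp, Submodule.finrank_sup_span_singleton hp',
    ← (Submodule.equivMapOfInjective _ LinearMap.inl_injective _).finrank_eq]

theorem homogenization_mem_hull_iff_mem_convexHull {𝕜 E : Type*} [Field 𝕜] [LinearOrder 𝕜]
    [IsStrictOrderedRing 𝕜] [AddCommGroup E] [Module 𝕜 E] {s : Set E} {x : E} :
    homogenization 𝕜 E x ∈ PointedCone.hull 𝕜 (homogenization 𝕜 E '' s) ↔ x ∈ convexHull 𝕜 s := by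
  constructor
  · intro h
    obtain ⟨c, hcs, hc, hsum⟩ := PointedCone.mem_hull_set.mp h
    have hsnd : ∀ m ∈ c.support, m.1 ∈ s ∧ m.2 = 1 := fun m hm => by
      obtain ⟨y, hy, rfl⟩ := hcs hm
      exact ⟨hy, rfl⟩
    have hx : ∑ m ∈ c.support, c m • m.1 = x := by
      simpa [Finsupp.sum, Prod.fst_sum] using congrArg Prod.fst hsum
    have hone : ∑ m ∈ c.support, c m = 1 := by
      have : ∑ m ∈ c.support, c m * m.2 = 1 := by
        simpa [Finsupp.sum, Prod.snd_sum] using congrArg Prod.snd hsum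
      rw [← this]
      exact Finset.sum_congr rfl fun m hm => by rw [(hsnd m hm).2, mul_one]
    exact hx ▸ (convex_convexHull 𝕜 s).sum_mem (fun m _ => hc m) hone
      fun m hm => subset_convexHull 𝕜 s (hsnd m hm).1
  · refine fun hx => convexHull_min (fun y hy => ?_)
      ((PointedCone.convex _).affine_preimage (homogenization 𝕜 E)) hx
    exact PointedCone.subset_hull (Set.mem_image_of_mem _ hy)

end ConvexHull

section Polyhedron

/-- The closed polyhedron cut out by the affine inequalities `φ x ≤ 0` for `φ ∈ F`. -/
def polyhedron {𝕜 E : Type*} [Ring 𝕜] [LE 𝕜] [AddCommGroup E] [Module 𝕜 E]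
    (F : Finset (E →ᵃ[𝕜] 𝕜)) : Set E :=
  {x | ∀ φ ∈ F, φ x ≤ 0}

theorem exists_polyhedron_eq_convexHull {𝕜 E : Type*} [Field 𝕜] [LinearOrder 𝕜]
    [IsStrictOrderedRing 𝕜] [AddCommGroup E] [Module 𝕜 E]
    [FiniteDimensional 𝕜 E] (s : Finset E) :
    ∃ F : Finset (E →ᵃ[𝕜] 𝕜),
      F.card ≤ s.card.choose (finrank 𝕜 (vectorSpan 𝕜 (s : Set E))) +
        2 * (finrank 𝕜 E - finrank 𝕜 (vectorSpan 𝕜 (s : Set E))) ∧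
      polyhedron F = convexHull 𝕜 (s : Set E) := by
  classical
  rcases s.eq_empty_or_nonempty with rfl | hs
  · refine ⟨{AffineMap.const 𝕜 E 1}, ?_, ?_⟩
    · rw [Finset.coe_empty, vectorSpan_empty]
      simp
    · simp [polyhedron, Set.eq_empty_iff_forall_notMem]
  obtain ⟨F, hFc, hF⟩ :=
    exists_finset_dual_eq_hull (𝕜 := 𝕜) (s.image (homogenization 𝕜 E))
  have hcard : (s.image (homogenization 𝕜 E)).card = s.card :=
    Finset.card_image_of_injective s fun x y h => congrArg Prod.fst h
  rw [Finset.coe_image, finrank_span_homogenization_image hs, hcard, finrank_prod, finrank_self,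
    Nat.add_sub_cancel, Nat.add_sub_add_right] at hFc
  refine ⟨F.image fun φ => -φ.toAffineMap.comp (homogenization 𝕜 E),
    Finset.card_image_le.trans hFc, ?_⟩
  ext x
  rw [← homogenization_mem_hull_iff_mem_convexHull, ← Finset.coe_image, ← hF]
  simp [polyhedron]

theorem exists_polyhedron_subset {𝕜 E : Type*} [Field 𝕜] [LinearOrder 𝕜] [IsStrictOrderedRing 𝕜]
    [AddCommGroup E] [Module 𝕜 E]
    [FiniteDimensional 𝕜 E] {n : ℕ} (hn : 2 * finrank 𝕜 E ≤ n) (hE : finrank 𝕜 E ≠ 1)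
    {s : Finset E} (hs : s.card ≤ n) {Q : Set E} (hQ : Convex 𝕜 Q) :
    ∃ F : Finset (E →ᵃ[𝕜] 𝕜), F.card ≤ n.choose (finrank 𝕜 E) ∧
      polyhedron F ⊆ Q ∧
      ∀ x ∈ s, x ∈ polyhedron F ↔ x ∈ Q := by
  classical
  obtain ⟨F, hFc, hF⟩ := exists_polyhedron_eq_convexHull (𝕜 := 𝕜) {x ∈ s | x ∈ Q}
  have hFQ : polyhedron F ⊆ Q :=
    hF.trans_subset (convexHull_min (fun x hx => (Finset.mem_filter.mp hx).2) hQ)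
  refine ⟨F, hFc.trans ?_, hFQ, fun x hx => ⟨fun h => hFQ h, fun h => ?_⟩⟩
  · exact (Nat.add_le_add_right (Nat.choose_le_choose _ ((Finset.card_filter_le s _).trans hs))
      _).trans (choose_add_two_mul_sub_le_choose (Submodule.finrank_le _) hn hE)
  · exact hF ▸ subset_convexHull 𝕜 _ (Finset.mem_filter.mpr ⟨hx, h⟩)

theorem exists_polyhedron_superset {E : Type*} [AddCommGroup E] [Module ℝ E]
    [TopologicalSpace E] [IsTopologicalAddGroup E] [ContinuousSMul ℝ E] [LocallyConvexSpace ℝ E]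
    (s : Finset E) {Q : Set E} (hQc : IsClosed Q) (hQ : Convex ℝ Q) :
    ∃ F : Finset (E →ᵃ[ℝ] ℝ), F.card ≤ s.card ∧ Q ⊆ polyhedron F ∧
      ∀ x ∈ s, x ∈ polyhedron F ↔ x ∈ Q := by
  classical
  have hsep : ∀ x ∉ Q, ∃ φ : E →ᵃ[ℝ] ℝ, (∀ y ∈ Q, φ y ≤ 0) ∧ 0 < φ x := fun x hx => by
    obtain ⟨φ, u, hφQ, hφx⟩ := geometric_hahn_banach_closed_point hQ hQc hx
    refine ⟨φ.toLinearMap.toAffineMap - AffineMap.const ℝ E u, fun y hy => ?_, ?_⟩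
    · simpa using (hφQ y hy).le
    · simpa using hφx
  choose! φ hφQ hφx using hsep
  have hsub : Q ⊆ polyhedron ({x ∈ s | x ∉ Q}.image φ) := by
    intro y hy ψ hψ
    obtain ⟨x, hx, rfl⟩ := Finset.mem_image.mp hψ
    exact hφQ x (Finset.mem_filter.mp hx).2 y hy
  refine ⟨_, Finset.card_image_le.trans (Finset.card_filter_le s _), hsub,
    fun x hx => ⟨fun h => ?_, fun h => hsub h⟩⟩
  by_contra hxQ
  exact (hφx x hxQ).not_ge
    (h _ (Finset.mem_image_of_mem φ (Finset.mem_filter.mpr ⟨hx, hxQ⟩)))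

theorem exists_forall_dotProduct_add_eq {ι : Type*} [Fintype ι] (φ : (ι → ℝ) →ᵃ[ℝ] ℝ) :
    ∃ (w : ι → ℝ) (b : ℝ), ∀ a, w ⬝ᵥ a + b = φ a := by
  classical
  refine ⟨(dotProductEquiv ℝ ι).symm φ.linear, φ 0, fun a => ?_⟩
  rw [congrFun φ.decomp a, Pi.add_apply, ← dotProductEquiv_apply_apply,
    LinearEquiv.apply_symm_apply]

theorem polyhedron_mem_closedConvexPolytopes {C K : ℕ} {F : Finset (Ambient C →ᵃ[ℝ] ℝ)}
    (hF : F.card ≤ K) : polyhedron F ∈ closedConvexPolytopes C K := by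
  let e : F ↪ Fin K := F.equivFin.toEmbedding.trans (Fin.castLEEmb hF)
  choose w b hwb using exists_forall_dotProduct_add_eq (ι := Fin C ⊕ Fin C)
  refine ⟨fun i => w (Function.extend e (↑) 0 i), fun i => b (Function.extend e (↑) 0 i), ?_⟩
  ext a
  simp only [hwb, Set.mem_ofPred_eq]
  refine ⟨fun h i => ?_, fun h φ hφ => ?_⟩
  · by_cases hi : ∃ φ, e φ = i
    · obtain ⟨φ, rfl⟩ := hi
      rw [e.injective.extend_apply]
      exact h φ φ.2
    · simp [Function.extend_apply' _ _ _ hi]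
  · simpa only [e.injective.extend_apply] using h (e ⟨φ, hφ⟩)

theorem closedConvexPolytopes_subset_closedConvexSets (C K : ℕ) :
    closedConvexPolytopes C K ⊆ closedConvexSets C := by
  rintro _ ⟨w, b, rfl⟩
  rw [Set.ofPred_forall]
  refine ⟨isClosed_iInter fun i => isClosed_le (by fun_prop) continuous_const,
    convex_iInter fun i => ?_⟩
  simp only [← le_neg_iff_add_nonpos_right]
  exact convex_halfSpace_le (dotProductEquiv ℝ _ (w i)).isLinear (-b i)

end Polyhedron

section Discrepancy

variable {X : Type*} {C n : ℕ} {P Q R : Set (Ambient C)}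

theorem sampleProb_congr {f : X → Fin C → ℝ} {S : Fin n → X × Fin C}
    (h : ∀ i, feature f (S i) ∈ P ↔ feature f (S i) ∈ Q) :
    sampleProb f S P = sampleProb f S Q := by
  simp only [sampleProb, h]

theorem sampleProb_nonneg (f : X → Fin C → ℝ) (S : Fin n → X × Fin C) (Q : Set (Ambient C)) :
    0 ≤ sampleProb f S Q := by
  unfold sampleProb
  positivity

theorem sampleProb_le_one (f : X → Fin C → ℝ) (S : Fin n → X × Fin C) (Q : Set (Ambient C)) :
    sampleProb f S Q ≤ 1 := by
  refine div_le_one_of_le₀ ?_ n.cast_nonneg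
  exact_mod_cast (Finite.card_subtype_le _).trans_eq (Nat.card_fin n)

variable [MeasurableSpace X] (f : X → Fin C → ℝ) (S : Fin n → X × Fin C)
  (𝒟 : Measure (X × Fin C))

theorem distProb_nonneg (Q : Set (Ambient C)) : 0 ≤ distProb f 𝒟 Q :=
  measureReal_nonneg

variable [IsFiniteMeasure 𝒟]

theorem distProb_mono (h : P ⊆ Q) : distProb f 𝒟 P ≤ distProb f 𝒟 Q :=
  measureReal_mono fun _ hz => h hz

theorem distProb_le (Q : Set (Ambient C)) : distProb f 𝒟 Q ≤ 𝒟.real Set.univ :=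
  measureReal_mono (Set.subset_univ _)

theorem bddAbove_image_discrepancyOn (𝒬 : Set (Set (Ambient C))) :
    BddAbove (discrepancyOn f S 𝒟 '' 𝒬) := by
  refine ⟨1 + 𝒟.real Set.univ, ?_⟩
  rintro _ ⟨Q, -, rfl⟩
  refine (abs_sub _ _).trans ?_
  rw [abs_of_nonneg (sampleProb_nonneg f S Q), abs_of_nonneg (distProb_nonneg f 𝒟 Q)]
  exact add_le_add (sampleProb_le_one f S Q) (distProb_le f 𝒟 Q)

theorem discrepancy_mono {𝒜 𝒬 : Set (Set (Ambient C))} (h : 𝒜 ⊆ 𝒬) (hne : 𝒜.Nonempty) :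
    discrepancy f S 𝒟 𝒜 ≤ discrepancy f S 𝒟 𝒬 :=
  csSup_le_csSup (bddAbove_image_discrepancyOn f S 𝒟 𝒬) (hne.image _) (Set.image_mono h)

variable {f S}

theorem discrepancyOn_le_max (hPQ : P ⊆ Q) (hQR : Q ⊆ R)
    (hP : ∀ i, feature f (S i) ∈ P ↔ feature f (S i) ∈ Q)
    (hR : ∀ i, feature f (S i) ∈ R ↔ feature f (S i) ∈ Q) :
    discrepancyOn f S 𝒟 Q ≤ max (discrepancyOn f S 𝒟 P) (discrepancyOn f S 𝒟 R) := by
  rw [max_comm]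
  unfold discrepancyOn
  rw [sampleProb_congr hP, sampleProb_congr hR]
  exact abs_le_max_abs_abs (sub_le_sub_left (distProb_mono f 𝒟 hQR) _)
    (sub_le_sub_left (distProb_mono f 𝒟 hPQ) _)

theorem discrepancy_le_of_forall_exists_subset_superset {𝒜 𝒬 : Set (Set (Ambient C))}
    (h : ∀ Q ∈ 𝒬, ∃ P ∈ 𝒜, ∃ R ∈ 𝒜, (P ⊆ Q ∧ ∀ i, feature f (S i) ∈ P ↔ feature f (S i) ∈ Q) ∧
      Q ⊆ R ∧ ∀ i, feature f (S i) ∈ R ↔ feature f (S i) ∈ Q) :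
    discrepancy f S 𝒟 𝒬 ≤ discrepancy f S 𝒟 𝒜 := by
  refine Real.sSup_le ?_ (Real.sSup_nonneg ?_)
  · rintro _ ⟨Q, hQ, rfl⟩
    obtain ⟨P, hP, R, hR, ⟨hPQ, hPS⟩, hQR, hRS⟩ := h Q hQ
    have hbdd := bddAbove_image_discrepancyOn f S 𝒟 𝒜
    exact (discrepancyOn_le_max 𝒟 hPQ hQR hPS hRS).trans
      (max_le (le_csSup hbdd ⟨P, hP, rfl⟩) (le_csSup hbdd ⟨R, hR, rfl⟩))
  · rintro _ ⟨P, -, rfl⟩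
    exact abs_nonneg _

end Discrepancy

end CvxDiscrepancy

open CvxDiscrepancy

theorem proposition2_general {X : Type*} [MeasurableSpace X] {C n K : ℕ} (f : X → Fin C → ℝ)
    (𝒟 : Measure (X × Fin C)) [IsFiniteMeasure 𝒟] (S : Fin n → X × Fin C) (hn : 4 * C ≤ n)
    (hK : n.choose (2 * C) ≤ K) :
    discrepancy f S 𝒟 (closedConvexSets C) = discrepancy f S 𝒟 (closedConvexPolytopes C K) := by
  classical
  have hdim : finrank ℝ (Ambient C) = 2 * C := by simp [two_mul]
  have hnK : n ≤ K := by
    rcases n.eq_zero_or_pos with rfl | hpos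
    · exact K.zero_le
    · have := (S ⟨0, hpos⟩).2.pos
      exact (self_le_choose (by omega) (by omega)).trans hK
  let s := Finset.univ.image fun i => feature f (S i)
  have hs : s.card ≤ n := Finset.card_image_le.trans_eq (Finset.card_fin n)
  have hmem : ∀ i, feature f (S i) ∈ s := fun i => Finset.mem_image_of_mem _ (Finset.mem_univ i)
  refine le_antisymm (discrepancy_le_of_forall_exists_subset_superset 𝒟 fun Q hQ => ?_)
    (discrepancy_mono f S 𝒟 (closedConvexPolytopes_subset_closedConvexSets C K) ⟨_, 0, 0, rfl⟩)
  obtain ⟨F, hF, hFQ, hFs⟩ := exists_polyhedron_subset (by omega) (by omega) hs hQ.2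
  obtain ⟨G, hG, hQG, hGs⟩ := exists_polyhedron_superset s hQ.1 hQ.2
  exact ⟨_, polyhedron_mem_closedConvexPolytopes ((hF.trans_eq (by rw [hdim])).trans hK),
    _, polyhedron_mem_closedConvexPolytopes (hG.trans (hs.trans hnK)),
    ⟨hFQ, fun i => hFs _ (hmem i)⟩, hQG, fun i => hGs _ (hmem i)⟩

theorem proposition2 {X : Type*} [MeasurableSpace X] (C n : ℕ)
    (f : X → Fin C → ℝ) (hf : Measurable f) (hfΔ : ∀ x, f x ∈ stdSimplex ℝ (Fin C))
    (𝒟 : Measure (X × Fin C)) [IsProbabilityMeasure 𝒟]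
    (S : Fin n → X × Fin C) (hn : 4 * C ≤ n) :
    CvxDiscrepancy.discrepancy f S 𝒟 (CvxDiscrepancy.closedConvexSets C) =
      CvxDiscrepancy.discrepancy f S 𝒟
        (CvxDiscrepancy.closedConvexPolytopes C (n.choose (2 * C))) :=
  proposition2_general f 𝒟 S hn le_rfl
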